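/- Let $\sigma>0$ and $\mathsf P\in\mathbb R$. Let $X$ be a real random variable with $\mathsf E[X^2]\le \mathsf P$, let $N$ be Gaussian with mean $0$ and variance $\sigma^2$, and for every $\Delta>0$ let $U_\Delta$ be uniformly distributed on $[-\Delta/2,\Delta/2]$, such that $X$, $N$ and $U_\Delta$ are mutually independent. Put $Z_\Delta=N+U_\Delta$, and let $I(\cdot\,;\cdot)$ denote mutual information, i.e. the relative entropy of the joint law with respect to the product of the marginal laws. Then $I(X;X+N)<\infty$ and $$\lim_{\Delta\downarrow 0} I(X;X+Z_\Delta)=I(X;X+N).$$ -/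

import Mathlib

open MeasureTheory ProbabilityTheory InformationTheory Filter Topology
open scoped ENNReal NNReal

/-- The mutual information `I(X; Y)` (in nats) of two random variables on `(Ω, P)`: the relative
entropy of their joint law with respect to the product of their laws, a value in `[0, ∞]`. -/
noncomputable def mutualInfo {Ω α β : Type*} [MeasurableSpace Ω] [MeasurableSpace α]
    [MeasurableSpace β] (X : Ω → α) (Y : Ω → β) (P : Measure Ω) : ℝ≥0∞ :=
  klDiv (P.map (fun ω => (X ω, Y ω))) ((P.map X).prod (P.map Y))

/-! Relative to (law of `X`) ⊗ Lebesgue, `(X, X + Z)` has density `p (y - x)` and the product of the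
marginals has density `q y`. Mutual information is therefore the integral of `q * klFun (p / q)`,
nonnegative, over a measure independent of the noise (`mutualInfo_add_eq_lintegral`). For `Δ ≤ 1`
the density of `Z_Δ` averages Gaussian shifts by at most `1/2`, so it lies between two fixed
Gaussian profiles. The upper profile controls `p` and `log p`; the lower one, with Jensen and the
second moment of `X`, bounds `-log q` by a quadratic. This gives one integrable majorant
(`channelKlIntegrand_le_bound`, `integrable_channelKlBound`), hence finiteness and, by dominated
convergence, the limit. -/

/-- The density at `y` of `X + Z` when `X` has law `ν` and `Z` is independent of `X` with
density `p`. -/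
noncomputable def translateMixture (ν : Measure ℝ) (p : ℝ → ℝ) (y : ℝ) : ℝ :=
  ∫ x, p (y - x) ∂ν

lemma measurable_translateMixture {ν : Measure ℝ} [SFinite ν] {p : ℝ → ℝ} (hp : Measurable p) :
    Measurable (translateMixture ν p) :=
  (StronglyMeasurable.integral_prod_left' (μ := ν) (f := fun w : ℝ × ℝ => p (w.2 - w.1))
    (by fun_prop : Measurable fun w : ℝ × ℝ => p (w.2 - w.1)).stronglyMeasurable).measurable

lemma integrable_translate_of_bounded {ν : Measure ℝ} [IsFiniteMeasure ν] {p : ℝ → ℝ}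
    (hp : Measurable p) (hp0 : ∀ z, 0 ≤ p z) {C : ℝ} (hC : ∀ z, p z ≤ C) (y : ℝ) :
    Integrable (fun x => p (y - x)) ν :=
  Integrable.of_bound (by fun_prop : Measurable fun x => p (y - x)).aestronglyMeasurable C
    (ae_of_all _ fun x => by rw [Real.norm_of_nonneg (hp0 _)]; exact hC _)

/-- The shear `(x, z) ↦ (x, x + z)` preserves the product of any law with Lebesgue measure. -/
lemma map_prodMk_add_eq_withDensity {Ω : Type*} [MeasurableSpace Ω] {μ : Measure Ω}
    [IsProbabilityMeasure μ] {X Z : Ω → ℝ} (hX : AEMeasurable X μ) (hZ : AEMeasurable Z μ)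
    (h : IndepFun X Z μ) {p : ℝ → ℝ} (hp : Measurable p)
    (hlaw : μ.map Z = volume.withDensity fun z => ENNReal.ofReal (p z)) :
    μ.map (fun ω => (X ω, X ω + Z ω)) =
      ((μ.map X).prod volume).withDensity fun w => ENNReal.ofReal (p (w.2 - w.1)) := by
  have := Measure.isProbabilityMeasure_map hX
  have hpair := (indepFun_iff_map_prod_eq_prod_map_map hX hZ).1 h
  rw [hlaw, prod_withDensity_right (by fun_prop)] at hpair
  have hshear : Measurable fun w : ℝ × ℝ => (w.1, w.1 + w.2) := by fun_prop
  have hcomp : μ.map (fun ω => (X ω, X ω + Z ω)) =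
      (μ.map fun ω => (X ω, Z ω)).map fun w : ℝ × ℝ => (w.1, w.1 + w.2) := by
    rw [AEMeasurable.map_map_of_aemeasurable hshear.aemeasurable (hX.prodMk hZ)]
    rfl
  rw [hcomp, hpair]
  refine Measure.ext_of_lintegral _ fun φ hφ => ?_
  rw [lintegral_map hφ hshear,
    lintegral_withDensity_eq_lintegral_mul _ (by fun_prop)
      (by fun_prop : Measurable fun w : ℝ × ℝ => φ (w.1, w.1 + w.2)),
    lintegral_withDensity_eq_lintegral_mul _ (by fun_prop) hφ]
  refine Eq.trans ?_ ((measurePreserving_prod_add (μ.map X) (volume : Measure ℝ)).lintegral_comp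
    (by fun_prop))
  simp

lemma map_add_eq_withDensity {Ω : Type*} [MeasurableSpace Ω] {μ : Measure Ω}
    [IsProbabilityMeasure μ] {X Z : Ω → ℝ} (hX : AEMeasurable X μ) (hZ : AEMeasurable Z μ)
    (h : IndepFun X Z μ) {p : ℝ → ℝ} (hp : Measurable p) (hp0 : ∀ z, 0 ≤ p z) {C : ℝ}
    (hC : ∀ z, p z ≤ C)
    (hlaw : μ.map Z = volume.withDensity fun z => ENNReal.ofReal (p z)) :
    μ.map (fun ω => X ω + Z ω) =
      volume.withDensity fun y => ENNReal.ofReal (translateMixture (μ.map X) p y) := by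
  have := Measure.isProbabilityMeasure_map hX
  have hcomp : μ.map (fun ω => X ω + Z ω) =
      (μ.map fun ω => (X ω, X ω + Z ω)).map Prod.snd := by
    rw [AEMeasurable.map_map_of_aemeasurable measurable_snd.aemeasurable
      (hX.prodMk (by fun_prop : AEMeasurable (fun ω => X ω + Z ω) μ))]
    rfl
  have hq := measurable_translateMixture (ν := μ.map X) hp
  rw [hcomp, map_prodMk_add_eq_withDensity hX hZ h hp hlaw]
  refine Measure.ext_of_lintegral _ fun φ hφ => ?_
  rw [lintegral_map hφ measurable_snd,
    lintegral_withDensity_eq_lintegral_mul _ (by fun_prop)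
      (by fun_prop : Measurable fun w : ℝ × ℝ => φ w.2),
    lintegral_withDensity_eq_lintegral_mul _ (by fun_prop) hφ,
    lintegral_prod_symm' _ (by fun_prop)]
  refine lintegral_congr fun y => ?_
  simp only [Pi.mul_apply, translateMixture]
  rw [lintegral_mul_const _ (by fun_prop),
    ofReal_integral_eq_lintegral_ofReal (integrable_translate_of_bounded hp hp0 hC y)
      (ae_of_all _ fun x => hp0 _)]

/-! ### Mutual information as an integral over a fixed measure -/

/-- The nonnegative integrand whose integral is the mutual information of `X` and `X + Z`. -/
noncomputable def channelKlIntegrand (ν : Measure ℝ) (p : ℝ → ℝ) (w : ℝ × ℝ) : ℝ :=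
  translateMixture ν p w.2 * klFun (p (w.2 - w.1) / translateMixture ν p w.2)

lemma measurable_channelKlIntegrand {ν : Measure ℝ} [SFinite ν] {p : ℝ → ℝ} (hp : Measurable p) :
    Measurable (channelKlIntegrand ν p) := by
  have hq := measurable_translateMixture (ν := ν) hp
  have := measurable_klFun
  unfold channelKlIntegrand
  fun_prop

lemma translateMixture_pos {ν : Measure ℝ} [IsProbabilityMeasure ν] {p : ℝ → ℝ}
    (hp : Measurable p) (hp0 : ∀ z, 0 < p z) {C : ℝ} (hC : ∀ z, p z ≤ C) (y : ℝ) :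
    0 < translateMixture ν p y := by
  rw [translateMixture, integral_pos_iff_support_of_nonneg (fun x => (hp0 _).le)
    (integrable_translate_of_bounded hp (fun z => (hp0 z).le) hC y)]
  have : Function.support (fun x => p (y - x)) = Set.univ := by
    ext x; simp [(hp0 (y - x)).ne']
  simp [this]

lemma mutualInfo_add_eq_lintegral {Ω : Type*} [MeasurableSpace Ω] {μ : Measure Ω}
    [IsProbabilityMeasure μ] {X Z : Ω → ℝ} (hX : AEMeasurable X μ) (hZ : AEMeasurable Z μ)
    (h : IndepFun X Z μ) {p : ℝ → ℝ} (hp : Measurable p) (hp0 : ∀ z, 0 < p z) {C : ℝ}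
    (hC : ∀ z, p z ≤ C)
    (hlaw : μ.map Z = volume.withDensity fun z => ENNReal.ofReal (p z)) :
    mutualInfo X (fun ω => X ω + Z ω) μ =
      ∫⁻ w, ENNReal.ofReal (channelKlIntegrand (μ.map X) p w) ∂((μ.map X).prod volume) := by
  have := Measure.isProbabilityMeasure_map hX
  have : IsProbabilityMeasure (μ.map fun ω => (X ω, X ω + Z ω)) :=
    Measure.isProbabilityMeasure_map (hX.prodMk (hX.add hZ))
  have : IsProbabilityMeasure (μ.map fun ω => X ω + Z ω) :=
    Measure.isProbabilityMeasure_map (hX.add hZ)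
  have hq := measurable_translateMixture (ν := μ.map X) hp
  have hqpos := translateMixture_pos (ν := μ.map X) hp hp0 hC
  have hprod : (μ.map X).prod (μ.map fun ω => X ω + Z ω) = ((μ.map X).prod volume).withDensity
      fun w => ENNReal.ofReal (translateMixture (μ.map X) p w.2) := by
    rw [map_add_eq_withDensity hX hZ h hp (fun z => (hp0 z).le) hC hlaw,
      prod_withDensity_right (by fun_prop)]
  have hjoint : μ.map (fun ω => (X ω, X ω + Z ω)) =
      ((μ.map X).prod (μ.map fun ω => X ω + Z ω)).withDensity fun w =>
        ENNReal.ofReal (p (w.2 - w.1) / translateMixture (μ.map X) p w.2) := by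
    rw [hprod, ← withDensity_mul _ (by fun_prop) (by fun_prop),
      map_prodMk_add_eq_withDensity hX hZ h hp hlaw]
    congr 1
    ext w
    simp only [Pi.mul_apply]
    rw [← ENNReal.ofReal_mul (hqpos _).le, mul_div_cancel₀ _ (hqpos _).ne']
  have hac : μ.map (fun ω => (X ω, X ω + Z ω)) ≪
      (μ.map X).prod (μ.map fun ω => X ω + Z ω) := by
    rw [hjoint]; exact withDensity_absolutelyContinuous _ _
  have hder : (μ.map fun ω => (X ω, X ω + Z ω)).rnDeriv
        ((μ.map X).prod (μ.map fun ω => X ω + Z ω))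
      =ᵐ[(μ.map X).prod (μ.map fun ω => X ω + Z ω)] fun w =>
        ENNReal.ofReal (p (w.2 - w.1) / translateMixture (μ.map X) p w.2) := by
    conv_lhs => rw [hjoint]
    exact Measure.rnDeriv_withDensity _ (by fun_prop)
  have hkl := measurable_klFun
  rw [mutualInfo, klDiv_eq_lintegral_klFun_of_ac hac]
  calc _ = ∫⁻ w, ENNReal.ofReal (klFun (p (w.2 - w.1) / translateMixture (μ.map X) p w.2))
          ∂((μ.map X).prod (μ.map fun ω => X ω + Z ω)) := by
        refine lintegral_congr_ae ?_
        filter_upwards [hder] with w hw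
        rw [hw, ENNReal.toReal_ofReal (div_nonneg (hp0 _).le (hqpos _).le)]
    _ = _ := by
        rw [hprod, lintegral_withDensity_eq_lintegral_mul _ (by fun_prop) (by fun_prop)]
        refine lintegral_congr fun w => ?_
        simp only [Pi.mul_apply]
        rw [← ENNReal.ofReal_mul (hqpos _).le, channelKlIntegrand]

/-! ### A majorant uniform in the noise density -/

/-- Jensen for `exp`, after `(y - x)² ≤ 2y² + 2x²`. -/
lemma exp_neg_mul_secondMoment_le_translateMixture {ν : Measure ℝ} [IsProbabilityMeasure ν]
    (hν : Integrable (fun x => x ^ 2) ν) {p : ℝ → ℝ} {a b : ℝ} (ha : 0 < a)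
    (hb : 0 ≤ b) (hlow : ∀ z, a * Real.exp (-b * z ^ 2) ≤ p z) (y : ℝ)
    (hint : Integrable (fun x => p (y - x)) ν) :
    a * Real.exp (-b * (2 * y ^ 2 + 2 * ∫ x, x ^ 2 ∂ν)) ≤ translateMixture ν p y := by
  have hi : Integrable (fun x => -b * (2 * y ^ 2 + 2 * x ^ 2)) ν :=
    ((integrable_const _).add (hν.const_mul 2)).const_mul _
  have hle : ∀ x, a * Real.exp (-b * (2 * y ^ 2 + 2 * x ^ 2)) ≤ p (y - x) := fun x => by
    refine le_trans ?_ (hlow _)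
    gcongr a * Real.exp ?_
    nlinarith [mul_nonneg hb (sq_nonneg (y + x))]
  have hie : Integrable (fun x => Real.exp (-b * (2 * y ^ 2 + 2 * x ^ 2))) ν := by
    refine Integrable.of_bound (by fun_prop) 1 (ae_of_all _ fun x => ?_)
    rw [Real.norm_of_nonneg (Real.exp_pos _).le, Real.exp_le_one_iff]
    have : 0 ≤ b * (2 * y ^ 2 + 2 * x ^ 2) := by positivity
    linarith
  have hj := convexOn_exp.map_integral_le Real.continuous_exp.continuousOn isClosed_univ
    (ae_of_all _ fun x => Set.mem_univ _) hi hie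
  rw [integral_const_mul, integral_add (integrable_const _) (hν.const_mul 2),
    integral_const_mul (μ := ν) 2 (fun x => x ^ 2)] at hj
  simp only [integral_const, probReal_univ, one_smul] at hj
  calc _ ≤ a * ∫ x, Real.exp (-b * (2 * y ^ 2 + 2 * x ^ 2)) ∂ν := by gcongr
    _ = ∫ x, a * Real.exp (-b * (2 * y ^ 2 + 2 * x ^ 2)) ∂ν := (integral_const_mul _ _).symm
    _ ≤ _ := integral_mono (hie.const_mul a) hint hle

/-- A function dominating `channelKlIntegrand ν p` for all densities `p` lying between
`a * exp (-b z²)` and `A * exp (-B z²)`; here `m` is the second moment of `ν`. -/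
noncomputable def channelKlBound (ν : Measure ℝ) (a b A B m : ℝ) (w : ℝ × ℝ) : ℝ :=
  A * Real.exp (-B * (w.2 - w.1) ^ 2) *
      (Real.log A - Real.log a + b * (4 * (w.2 - w.1) ^ 2 + 4 * w.1 ^ 2 + 2 * m)) +
    translateMixture ν (fun z => A * Real.exp (-B * z ^ 2)) w.2

/-- The integrand equals `p (log p - log q) + q - p`; the final `-p` is dropped. -/
lemma channelKlIntegrand_le_bound {ν : Measure ℝ} [IsProbabilityMeasure ν]
    (hν : Integrable (fun x => x ^ 2) ν) {p : ℝ → ℝ} (hp : Measurable p) {a b A B : ℝ}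
    (ha : 0 < a) (hb : 0 ≤ b) (hB : 0 ≤ B)
    (hlow : ∀ z, a * Real.exp (-b * z ^ 2) ≤ p z)
    (hup : ∀ z, p z ≤ A * Real.exp (-B * z ^ 2)) (w : ℝ × ℝ) :
    channelKlIntegrand ν p w ≤ channelKlBound ν a b A B (∫ x, x ^ 2 ∂ν) w := by
  obtain ⟨x, y⟩ := w
  have hp0 : ∀ z, 0 < p z := fun z => lt_of_lt_of_le (by positivity) (hlow z)
  have hA : 0 < A := pos_of_mul_pos_left ((hp0 0).trans_le (hup 0)) (Real.exp_pos _).le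
  have hexp : ∀ z, A * Real.exp (-B * z ^ 2) ≤ A := fun z => by
    refine mul_le_of_le_one_right hA.le (Real.exp_le_one_iff.2 ?_)
    have : 0 ≤ B * z ^ 2 := by positivity
    linarith
  have hpA : ∀ z, p z ≤ A := fun z => (hup z).trans (hexp z)
  have hint := integrable_translate_of_bounded (ν := ν) hp (fun z => (hp0 z).le) hpA y
  have hq := translateMixture_pos (ν := ν) hp hp0 hpA y
  have hqlow := exp_neg_mul_secondMoment_le_translateMixture hν ha hb hlow y hint
  have hqup : translateMixture ν p y ≤
      translateMixture ν (fun z => A * Real.exp (-B * z ^ 2)) y :=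
    integral_mono hint (integrable_translate_of_bounded (by fun_prop)
      (fun z => by positivity) hexp y) fun x => hup _
  have hlogq : Real.log a - b * (2 * y ^ 2 + 2 * ∫ x, x ^ 2 ∂ν) ≤
      Real.log (translateMixture ν p y) := by
    have := Real.log_le_log (by positivity) hqlow
    rw [Real.log_mul ha.ne' (Real.exp_pos _).ne', Real.log_exp] at this
    linarith
  have hlogp : Real.log (p (y - x)) ≤ Real.log A := Real.log_le_log (hp0 _) (hpA _)
  have hlogA : Real.log a ≤ Real.log A :=
    Real.log_le_log ha (by simpa using (hlow 0).trans (hpA 0))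
  have hm : 0 ≤ ∫ x, x ^ 2 ∂ν := integral_nonneg fun x => sq_nonneg x
  have hy : b * (2 * y ^ 2) ≤ b * (4 * (y - x) ^ 2 + 4 * x ^ 2) := by
    gcongr
    nlinarith [sq_nonneg (y - 2 * x)]
  have heq : channelKlIntegrand ν p (x, y) =
      p (y - x) * (Real.log (p (y - x)) - Real.log (translateMixture ν p y)) +
        translateMixture ν p y - p (y - x) := by
    simp only [channelKlIntegrand, klFun_apply]
    rw [Real.log_div (hp0 _).ne' hq.ne']
    field_simp
  rw [heq, channelKlBound]
  have h1 : p (y - x) * (Real.log (p (y - x)) - Real.log (translateMixture ν p y)) ≤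
      A * Real.exp (-B * (y - x) ^ 2) *
      (Real.log A - Real.log a + b * (4 * (y - x) ^ 2 + 4 * x ^ 2 + 2 * ∫ x, x ^ 2 ∂ν)) := by
    -- The logarithmic factor is enlarged first: the larger factor is nonnegative, so `p` may then
    -- be replaced by its envelope.
    refine (mul_le_mul_of_nonneg_left (a := p (y - x)) (c := Real.log A - Real.log a +
      b * (4 * (y - x) ^ 2 + 4 * x ^ 2 + 2 * ∫ x, x ^ 2 ∂ν)) ?_ (hp0 _).le).trans
      (mul_le_mul_of_nonneg_right (hup _) ?_)
    · linarith
    · have : 0 ≤ b * (4 * (y - x) ^ 2 + 4 * x ^ 2 + 2 * ∫ x, x ^ 2 ∂ν) := by positivity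
      linarith
  have := hp0 (y - x)
  dsimp only
  linarith

lemma integrable_comp_fst_sub {ν : Measure ℝ} [SFinite ν] {h : ℝ × ℝ → ℝ} (hm : Measurable h)
    (hh : Integrable h (ν.prod volume)) :
    Integrable (fun w : ℝ × ℝ => h (w.1, w.2 - w.1)) (ν.prod volume) := by
  have hmp := measurePreserving_prod_add ν (volume : Measure ℝ)
  rw [← hmp.integrable_comp (by fun_prop : Measurable fun w : ℝ × ℝ =>
    h (w.1, w.2 - w.1)).aestronglyMeasurable]
  simpa [Function.comp_def] using hh

lemma integrable_channelKlBound {ν : Measure ℝ} [IsProbabilityMeasure ν]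
    (hν : Integrable (fun x => x ^ 2) ν) (a b A m : ℝ) {B : ℝ} (hB : 0 < B) :
    Integrable (channelKlBound ν a b A B m) (ν.prod volume) := by
  have hg : Integrable (fun z : ℝ => Real.exp (-B * z ^ 2)) := integrable_exp_neg_mul_sq hB
  have hg2 : Integrable (fun z : ℝ => z ^ 2 * Real.exp (-B * z ^ 2)) := by
    simpa using integrable_rpow_mul_exp_neg_mul_sq hB (by norm_num : (-1 : ℝ) < 2)
  have hone : Integrable (fun _ : ℝ => (1 : ℝ)) ν := integrable_const _
  refine Integrable.add ?_ ?_
  · have h := integrable_comp_fst_sub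
      (h := fun w : ℝ × ℝ => A * Real.exp (-B * w.2 ^ 2) *
        (Real.log A - Real.log a + b * (4 * w.2 ^ 2 + 4 * w.1 ^ 2 + 2 * m)))
      (ν := ν) (by fun_prop) ?_
    · exact h
    -- In the coordinates `(x, z)` the bound is a sum of products of functions of `x` and of `z`.
    · refine ((((hone.mul_prod hg).const_mul (A * (Real.log A - Real.log a + b * 2 * m))).add
        ((hone.mul_prod hg2).const_mul (A * b * 4))).add
        ((hν.mul_prod hg).const_mul (A * b * 4))).congr (ae_of_all _ fun w => ?_)
      simp only [Pi.add_apply]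
      ring
  · have hk : Integrable (fun w : ℝ × ℝ => A * Real.exp (-B * (w.2 - w.1) ^ 2))
        (ν.prod volume) :=
      integrable_comp_fst_sub (h := fun w : ℝ × ℝ => A * Real.exp (-B * w.2 ^ 2)) (by fun_prop)
        (by simpa using (hone.mul_prod hg).const_mul A)
    simpa [translateMixture] using hone.mul_prod hk.integral_prod_right

/-! ### Finiteness and continuity in the noise density -/

lemma lintegral_channelKlIntegrand_ne_top {ν : Measure ℝ} [IsProbabilityMeasure ν]
    (hν : Integrable (fun x => x ^ 2) ν) {p : ℝ → ℝ} (hp : Measurable p) {a b A B : ℝ}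
    (ha : 0 < a) (hb : 0 ≤ b) (hB : 0 < B)
    (hlow : ∀ z, a * Real.exp (-b * z ^ 2) ≤ p z)
    (hup : ∀ z, p z ≤ A * Real.exp (-B * z ^ 2)) :
    ∫⁻ w, ENNReal.ofReal (channelKlIntegrand ν p w) ∂(ν.prod volume) ≠ ∞ :=
  ne_top_of_le_ne_top
    (integrable_channelKlBound hν a b A (∫ x, x ^ 2 ∂ν) hB).lintegral_lt_top.ne
    (lintegral_mono fun w => ENNReal.ofReal_le_ofReal
      (channelKlIntegrand_le_bound hν hp ha hb hB.le hlow hup w))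

lemma tendsto_lintegral_channelKlIntegrand {ι : Type*} {l : Filter ι} [l.IsCountablyGenerated]
    {ν : Measure ℝ} [IsProbabilityMeasure ν] (hν : Integrable (fun x => x ^ 2) ν)
    {p : ι → ℝ → ℝ} {p₀ : ℝ → ℝ} (hp : ∀ᶠ i in l, Measurable (p i)) (hp₀ : Measurable p₀)
    {a b A B : ℝ} (ha : 0 < a) (hb : 0 ≤ b) (hB : 0 < B)
    (hlow : ∀ᶠ i in l, ∀ z, a * Real.exp (-b * z ^ 2) ≤ p i z)
    (hup : ∀ᶠ i in l, ∀ z, p i z ≤ A * Real.exp (-B * z ^ 2))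
    (hlow₀ : ∀ z, a * Real.exp (-b * z ^ 2) ≤ p₀ z)
    (hup₀ : ∀ z, p₀ z ≤ A * Real.exp (-B * z ^ 2))
    (hlim : ∀ z, Tendsto (fun i => p i z) l (𝓝 (p₀ z))) :
    Tendsto (fun i => ∫⁻ w, ENNReal.ofReal (channelKlIntegrand ν (p i) w) ∂(ν.prod volume)) l
      (𝓝 (∫⁻ w, ENNReal.ofReal (channelKlIntegrand ν p₀ w) ∂(ν.prod volume))) := by
  have hp₀pos : ∀ z, 0 < p₀ z := fun z => lt_of_lt_of_le (by positivity) (hlow₀ z)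
  have hA : 0 < A := pos_of_mul_pos_left ((hp₀pos 0).trans_le (hup₀ 0)) (Real.exp_pos _).le
  have hexp : ∀ z, A * Real.exp (-B * z ^ 2) ≤ A := fun z => by
    refine mul_le_of_le_one_right hA.le (Real.exp_le_one_iff.2 ?_)
    have : 0 ≤ B * z ^ 2 := by positivity
    linarith
  refine tendsto_lintegral_filter_of_dominated_convergence
    (fun w => ENNReal.ofReal (channelKlBound ν a b A B (∫ x, x ^ 2 ∂ν) w)) ?_ ?_
    (integrable_channelKlBound hν a b A _ hB).lintegral_lt_top.ne (ae_of_all _ fun w => ?_)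
  · filter_upwards [hp] with i hi
    exact (measurable_channelKlIntegrand hi).ennreal_ofReal
  · filter_upwards [hp, hlow, hup] with i hi h1 h2
    exact ae_of_all _ fun w => ENNReal.ofReal_le_ofReal
      (channelKlIntegrand_le_bound hν hi ha hb hB.le h1 h2 w)
  -- Pointwise convergence needs an inner dominated convergence for `q`, with constant majorant `A`.
  · have hq : Tendsto (fun i => translateMixture ν (p i) w.2) l
        (𝓝 (translateMixture ν p₀ w.2)) := by
      refine tendsto_integral_filter_of_dominated_convergence (fun _ => A) ?_ ?_
        (integrable_const _) (ae_of_all _ fun x => hlim _)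
      · filter_upwards [hp] with i hi
        exact (by fun_prop : Measurable fun x => p i (w.2 - x)).aestronglyMeasurable
      · filter_upwards [hlow, hup] with i h1 h2
        refine ae_of_all _ fun x => ?_
        rw [Real.norm_of_nonneg (le_trans (by positivity) (h1 _))]
        exact (h2 _).trans (hexp _)
    have hq0 := translateMixture_pos (ν := ν) hp₀ hp₀pos (fun z => (hup₀ z).trans (hexp z)) w.2
    exact ENNReal.tendsto_ofReal (hq.mul
      ((continuous_klFun.tendsto _).comp ((hlim _).div hq hq0.ne')))

/-! ### Gaussian density smoothed by a small perturbation -/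

lemma abs_translateMixture_sub_le {κ : Measure ℝ} [IsProbabilityMeasure κ] {g : ℝ → ℝ} {z c : ℝ}
    (hint : Integrable (fun u => g (z - u)) κ) (h : ∀ᵐ u ∂κ, |g (z - u) - g z| ≤ c) :
    |translateMixture κ g z - g z| ≤ c := by
  have : translateMixture κ g z - g z = ∫ u, (g (z - u) - g z) ∂κ := by
    rw [integral_sub hint (integrable_const _)]
    simp [translateMixture]
  rw [this]
  simpa using norm_integral_le_of_norm_le_const (f := fun u => g (z - u) - g z) h

/-- The constants come from `z²/2 - u² ≤ (z - u)² ≤ 2z² + 2u²` with `u² ≤ 1/4`. -/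
lemma gaussianPDFReal_sub_mem_Icc {v : ℝ≥0} (hv : v ≠ 0) {u : ℝ} (hu : |u| ≤ 1 / 2) (z : ℝ) :
    gaussianPDFReal 0 v (z - u) ∈ Set.Icc
      ((√(2 * Real.pi * v))⁻¹ * Real.exp (-(1 / (4 * v))) * Real.exp (-(1 / v) * z ^ 2))
      ((√(2 * Real.pi * v))⁻¹ * Real.exp (1 / (8 * v)) * Real.exp (-(1 / (4 * v)) * z ^ 2)) := by
  have hv' : (0 : ℝ) < v := by positivity
  have hu2 : u ^ 2 ≤ 1 / 4 := by
    rw [← sq_abs]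
    nlinarith [abs_nonneg u]
  simp only [gaussianPDFReal, sub_zero, Set.mem_Icc]
  constructor <;> rw [mul_assoc (√(2 * Real.pi * v))⁻¹, ← Real.exp_add] <;> gcongr _ * Real.exp ?_
  · rw [← sub_nonneg]
    have : -(z - u) ^ 2 / (2 * v) - (-(1 / (4 * (v : ℝ))) + -(1 / v) * z ^ 2) =
      (1 / 2 - 2 * u ^ 2 + (z + u) ^ 2) / (2 * v) := by
      field_simp
      ring
    rw [this]
    refine div_nonneg ?_ (by positivity)
    nlinarith [sq_nonneg (z + u)]
  · rw [← sub_nonneg]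
    have : 1 / (8 * (v : ℝ)) + -(1 / (4 * v)) * z ^ 2 - -(z - u) ^ 2 / (2 * v) =
      (1 / 2 - 2 * u ^ 2 + (z - 2 * u) ^ 2) / (4 * (2 * v)) * 2 := by
      field_simp
      ring
    rw [this]
    refine mul_nonneg (div_nonneg ?_ (by positivity)) (by norm_num)
    nlinarith [sq_nonneg (z - 2 * u)]

theorem theorem1 {Ω : Type*} [MeasurableSpace Ω] (μ : Measure Ω) [IsProbabilityMeasure μ]
    (σ : ℝ≥0) (hσ : 0 < σ) (P : ℝ)
    (X N : Ω → ℝ) (U : ℝ → Ω → ℝ)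
    (hX : AEMeasurable X μ)
    (hX_int : Integrable (fun ω => X ω ^ 2) μ)
    (hX_power : ∫ ω, X ω ^ 2 ∂μ ≤ P)
    (hN : HasLaw N (gaussianReal 0 (σ ^ 2)) μ)
    (hU : ∀ Δ : ℝ, 0 < Δ → pdf.IsUniform (U Δ) (Set.Icc (-(Δ / 2)) (Δ / 2)) μ volume)
    (hindep : ∀ Δ : ℝ, 0 < Δ → iIndepFun ![X, N, U Δ] μ) :
    mutualInfo X (fun ω => X ω + N ω) μ ≠ ∞ ∧
    Tendsto (fun Δ : ℝ => mutualInfo X (fun ω => X ω + (N ω + U Δ ω)) μ)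
      (𝓝[>] 0) (𝓝 (mutualInfo X (fun ω => X ω + N ω) μ)) := by
  have hv : σ ^ 2 ≠ 0 := by positivity
  set g := gaussianPDFReal 0 (σ ^ 2) with hg
  set a := (√(2 * Real.pi * ↑(σ ^ 2)))⁻¹ * Real.exp (-(1 / (4 * ↑(σ ^ 2))))
  set b : ℝ := 1 / ↑(σ ^ 2)
  set A := (√(2 * Real.pi * ↑(σ ^ 2)))⁻¹ * Real.exp (1 / (8 * ↑(σ ^ 2)))
  set B : ℝ := 1 / (4 * ↑(σ ^ 2))
  have ha : 0 < a := by positivity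
  have hb : 0 ≤ b := by positivity
  have hA : 0 < A := by positivity
  have hB : 0 < B := by positivity
  have hexp : ∀ z, A * Real.exp (-B * z ^ 2) ≤ A := fun z => by
    refine mul_le_of_le_one_right hA.le (Real.exp_le_one_iff.2 ?_)
    have : 0 ≤ B * z ^ 2 := by positivity
    linarith
  have hbounds : ∀ u : ℝ, |u| ≤ 1 / 2 → ∀ z, g (z - u) ∈
      Set.Icc (a * Real.exp (-b * z ^ 2)) (A * Real.exp (-B * z ^ 2)) :=
    fun u hu z => gaussianPDFReal_sub_mem_Icc hv hu z
  have hg_meas : Measurable g := measurable_gaussianPDFReal _ _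
  have hg_cont : Continuous g := by
    rw [hg, gaussianPDFReal_def]
    fun_prop
  have hg_bounds : ∀ z, g z ∈
      Set.Icc (a * Real.exp (-b * z ^ 2)) (A * Real.exp (-B * z ^ 2)) := fun z => by
    simpa using hbounds 0 (by norm_num) z
  have hg_pos : ∀ z, 0 < g z := fun z => gaussianPDFReal_pos _ _ _ hv
  have hgA : ∀ z, g z ≤ A := fun z => (hg_bounds z).2.trans (hexp z)
  have hN_law : μ.map N = volume.withDensity fun z => ENNReal.ofReal (g z) := by
    rw [hN.map_eq, gaussianReal_of_var_ne_zero _ hv]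
    rfl
  have := Measure.isProbabilityMeasure_map hX
  have hν : Integrable (fun x => x ^ 2) (μ.map X) :=
    (integrable_map_measure (by fun_prop) hX).2 hX_int
  have hXN : IndepFun X N μ :=
    (hindep 1 one_pos).indepFun (i := 0) (j := 1) (by decide)
  have hlimit := mutualInfo_add_eq_lintegral hX hN.aemeasurable hXN hg_meas hg_pos hgA hN_law
  rw [hlimit]
  refine ⟨lintegral_channelKlIntegrand_ne_top hν hg_meas ha hb hB (fun z => (hg_bounds z).1)
    fun z => (hg_bounds z).2, ?_⟩
  have hvol : ∀ Δ : ℝ, 0 < Δ → volume (Set.Icc (-(Δ / 2)) (Δ / 2)) ≠ 0 := fun Δ hΔ => by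
    simpa using hΔ
  have hU_meas : ∀ Δ : ℝ, 0 < Δ → AEMeasurable (U Δ) μ := fun Δ hΔ =>
    (hU Δ hΔ).aemeasurable (hvol Δ hΔ) (by simp)
  have hU_prob : ∀ Δ : ℝ, 0 < Δ → IsProbabilityMeasure (μ.map (U Δ)) := fun Δ hΔ =>
    Measure.isProbabilityMeasure_map (hU_meas Δ hΔ)
  have hU_abs : ∀ Δ : ℝ, 0 < Δ → ∀ᵐ u ∂(μ.map (U Δ)), |u| ≤ Δ / 2 := fun Δ hΔ => by
    rw [hU Δ hΔ]
    filter_upwards [ae_cond_mem measurableSet_Icc] with u hu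
    exact abs_le.2 hu
  have hint : ∀ Δ : ℝ, 0 < Δ → ∀ z, Integrable (fun u => g (z - u)) (μ.map (U Δ)) :=
    fun Δ hΔ z => by
      have := hU_prob Δ hΔ
      exact integrable_translate_of_bounded hg_meas (fun z => (hg_pos z).le) hgA z
  have hsmall : ∀ᶠ Δ : ℝ in 𝓝[>] 0, 0 < Δ ∧ Δ ≤ 1 := by
    filter_upwards [Ioc_mem_nhdsGT (zero_lt_one' ℝ)] with Δ hΔ using hΔ
  have hmix_bounds : ∀ Δ : ℝ, 0 < Δ → Δ ≤ 1 → ∀ z, translateMixture (μ.map (U Δ)) g z ∈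
      Set.Icc (a * Real.exp (-b * z ^ 2)) (A * Real.exp (-B * z ^ 2)) := fun Δ hΔ hΔ1 z => by
    have := hU_prob Δ hΔ
    -- An average of values in a closed interval stays in it; `Δ ≤ 1` gives `|u| ≤ 1/2`.
    refine (convex_Icc _ _).integral_mem isClosed_Icc ?_ (hint Δ hΔ z)
    filter_upwards [hU_abs Δ hΔ] with u hu
    exact hbounds u (by linarith) z
  have hformula : ∀ Δ : ℝ, 0 < Δ → Δ ≤ 1 →
      mutualInfo X (fun ω => X ω + (N ω + U Δ ω)) μ =
        ∫⁻ w, ENNReal.ofReal (channelKlIntegrand (μ.map X)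
          (translateMixture (μ.map (U Δ)) g) w) ∂((μ.map X).prod volume) := fun Δ hΔ hΔ1 => by
    have := hU_prob Δ hΔ
    have hUN : IndepFun (U Δ) N μ := (hindep Δ hΔ).indepFun (i := 2) (j := 1) (by decide)
    have hXNU : IndepFun X (fun ω => N ω + U Δ ω) μ := by
      refine (hindep Δ hΔ).indepFun_add_right₀ (fun i => ?_) 0 1 2 (by decide) (by decide)
      fin_cases i
      exacts [hX, hN.aemeasurable, hU_meas Δ hΔ]
    refine mutualInfo_add_eq_lintegral hX (hN.aemeasurable.add (hU_meas Δ hΔ)) hXNU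
      (measurable_translateMixture hg_meas) (translateMixture_pos hg_meas hg_pos hgA)
      (fun z => (hmix_bounds Δ hΔ hΔ1 z).2.trans (hexp z)) ?_
    -- `U Δ` takes the role of the input and `N` that of the noise, so the density is `g` averaged
    -- over the law of `U Δ`.
    rw [add_comm N (U Δ)]
    exact map_add_eq_withDensity (hU_meas Δ hΔ) hN.aemeasurable hUN hg_meas
      (fun z => (hg_pos z).le) hgA hN_law
  have hlim : ∀ z, Tendsto (fun Δ : ℝ => translateMixture (μ.map (U Δ)) g z) (𝓝[>] 0)
      (𝓝 (g z)) := fun z => by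
    rw [Metric.tendsto_nhds]
    intro ε hε
    obtain ⟨δ, hδ, hcont⟩ := Metric.continuous_iff.1 hg_cont z (ε / 2) (by positivity)
    filter_upwards [Ioo_mem_nhdsGT hδ] with Δ hΔ
    have := hU_prob Δ hΔ.1
    refine (abs_translateMixture_sub_le (hint Δ hΔ.1 z) (c := ε / 2) ?_).trans_lt
      (half_lt_self hε)
    filter_upwards [hU_abs Δ hΔ.1] with u hu
    refine (hcont (z - u) ?_).le
    rw [Real.dist_eq, sub_sub_cancel_left, abs_neg]
    linarith [hΔ.1, hΔ.2]
  refine (tendsto_lintegral_channelKlIntegrand hν (a := a) (b := b) (A := A) (B := B) ?_ hg_meas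
    ha hb hB ?_ ?_ (fun z => (hg_bounds z).1) (fun z => (hg_bounds z).2) hlim).congr' ?_
  · filter_upwards [hsmall] with Δ hΔ
    have := hU_prob Δ hΔ.1
    exact measurable_translateMixture hg_meas
  · filter_upwards [hsmall] with Δ hΔ z using (hmix_bounds Δ hΔ.1 hΔ.2 z).1
  · filter_upwards [hsmall] with Δ hΔ z using (hmix_bounds Δ hΔ.1 hΔ.2 z).2
  · filter_upwards [hsmall] with Δ hΔ using (hformula Δ hΔ.1 hΔ.2).symm
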